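/- Let $\mathbb{D}=\{z\in\mathbb{C}:|z|<1\}$, and let $\mathcal{A}$ be the class of analytic functions $f$ in $\mathbb{D}$ with Taylor series $f(z)=z+\sum_{n=2}^{\infty}a_nz^n$. Let $\mathcal{S}^*$ be the class of univalent (one-to-one) functions $g\in\mathcal{A}$ for which $g(\mathbb{D})$ is starlike with respect to the origin, i.e. $t\,g(z)\in g(\mathbb{D})$ for all $z\in\mathbb{D}$ and $0\le t\le 1$. A function $f\in\mathcal{A}$ is called close-to-convex if there exist $g\in\mathcal{S}^*$ and a real number $\alpha\in(-\pi/2,\pi/2)$ such that $$\operatorname{Re}\left(e^{i\alpha}\,\frac{zf'(z)}{g(z)}\right)>0,\qquad z\in\mathbb{D},$$ where the quotient takes the value $1$ at the removable singularity $z=0$. If $f(z)=z+\sum_{n=2}^{\infty}a_nz^n$ is close-to-convex, then $$|a_2a_4-2a_3^2|\le \frac{21}{2}.$$ -/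

import Mathlib

/-- The open unit disk in the complex plane. -/
abbrev unitDisk : Set ℂ := Metric.ball (0 : ℂ) 1

/-- The `n`-th Taylor coefficient of `f` at the origin. -/
noncomputable def taylorCoeff (f : ℂ → ℂ) (n : ℕ) : ℂ :=
  iteratedDeriv n f 0 / (n.factorial : ℂ)

/-- The class `𝒜`: functions analytic in the unit disk with Taylor series
`z + a₂ z² + a₃ z³ + ⋯`, that is, normalized by `f 0 = 0` and `f' 0 = 1`. -/
structure IsNormalizedAnalytic (f : ℂ → ℂ) : Prop where
  analytic : AnalyticOnNhd ℂ f unitDisk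
  map_zero : f 0 = 0
  deriv_zero : deriv f 0 = 1

/-- The class `𝒮*`: univalent functions in `𝒜` whose image of the unit disk is starlike with
respect to the origin. -/
structure IsStarlike (g : ℂ → ℂ) : Prop where
  normalized : IsNormalizedAnalytic g
  univalent : Set.InjOn g unitDisk
  starConvex_image : StarConvex ℝ (0 : ℂ) (g '' unitDisk)

/-- The class `𝒦`: functions `f` in `𝒜` for which there are `g ∈ 𝒮*` and `α ∈ (-π/2, π/2)` with
`Re (e^{iα} z f'(z) / g(z)) > 0` in the unit disk. At `z = 0` the quotient has a removable
singularity with value `1`, where the condition reads `cos α > 0` and holds by the choice of `α`;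
so it is only required at `z ≠ 0`. -/
def IsCloseToConvex (f : ℂ → ℂ) : Prop :=
  IsNormalizedAnalytic f ∧
    ∃ g : ℂ → ℂ, IsStarlike g ∧
      ∃ α ∈ Set.Ioo (-(Real.pi / 2)) (Real.pi / 2),
        ∀ z ∈ unitDisk, z ≠ 0 →
          0 < (Complex.exp ((α : ℂ) * Complex.I) * (z * deriv f z / g z)).re

open Filter Topology Set

/-! Everything rests on the identity a₂a₄ - 2a₃² = a₂(18a₄ - 24a₂a₃ + 4a₂³)/18 - 2(3a₃ - a₂²)²/9.
With |a₂| ≤ 2, |3a₃ - a₂²| ≤ 5 and |18a₄ - 24a₂a₃ + 4a₂³| ≤ 42 it gives 92/9 < 21/2. For the Koebe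
coefficients aₙ = n the two summands are -40/9 and -50/9, so splitting them by the triangle
inequality loses nothing there.

The three bounds come from parametrizing the coefficients. Starlikeness gives Re(zg'/g) ≥ 0, hence
zg'/g = (1 + zs)/(1 - zs) with s analytic and |s| ≤ 1. Likewise zf'/g = (1 + xzr)/(1 - zr) with x =
e^{-2iα} and |r| ≤ 1. Thus a₂, a₃, a₄ are polynomials in the coefficients of s and r and in κ = (1 +
x)/2, which lies on the circle Re κ = |κ|². The Schur bounds |s₁|, |s₂| ≤ 1 - |s₀|², and the same
for r, reduce each estimate to real polynomials in |s₀|, |r₀| and |κ|. -/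

/-! ### Polynomial estimates on the circle Re κ = |κ|² and on Schur coefficients -/

theorem norm_le_of_sq_add_sq_le {z : ℂ} {M : ℝ} (hM : 0 ≤ M) (h : z.re ^ 2 + z.im ^ 2 ≤ M ^ 2) :
    ‖z‖ ≤ M := by
  refine abs_le_of_sq_le_sq' ?_ hM |>.2
  rw [Complex.sq_norm, Complex.normSq_apply]
  linarith

/-- On the circle the squared norm is 4k² - 3k⁴, and (3 - 2k)² exceeds it by 3(1 - k)(3 - k - k² -
k³). A bound linear in k lets `norm_quadratic_combination_le` be handled as an affine function of k.
-/
theorem norm_two_mul_sub_sq_le {κ : ℂ} {k : ℝ} (hk0 : 0 ≤ k) (hk1 : k ≤ 1)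
    (hre : κ.re = k ^ 2) (him : κ.im ^ 2 = k ^ 2 - k ^ 4) :
    ‖2 * κ - κ ^ 2‖ ≤ 3 - 2 * k := by
  apply norm_le_of_sq_add_sq_le (by linarith)
  have e : (2 * κ - κ ^ 2).re ^ 2 + (2 * κ - κ ^ 2).im ^ 2 = 4 * k ^ 2 - 3 * k ^ 4 := by
    simp only [pow_two κ, Complex.sub_re, Complex.sub_im, Complex.mul_re, Complex.mul_im,
      Complex.re_ofNat, Complex.im_ofNat, hre]
    linear_combination (κ.im ^ 2 + (k ^ 2 - k ^ 4) + 2 * k ^ 4 + 4 - 4 * k ^ 2) * him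
  rw [e]
  have : 0 ≤ (1 - k) * (3 - k - k ^ 2 - k ^ 3) := by
    apply mul_nonneg (by linarith)
    nlinarith [pow_le_one₀ hk0 hk1 (n := 2), pow_le_one₀ hk0 hk1 (n := 3)]
  nlinarith

theorem norm_two_mul_sub_twenty_mul_sq_le {κ : ℂ} {k : ℝ} (hk0 : 0 ≤ k) (hk1 : k ≤ 1)
    (hre : κ.re = k ^ 2) (him : κ.im ^ 2 = k ^ 2 - k ^ 4) :
    ‖2 * κ - 20 * κ ^ 2‖ ≤ 18 := by
  apply norm_le_of_sq_add_sq_le (by norm_num)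
  have e : (2 * κ - 20 * κ ^ 2).re ^ 2 + (2 * κ - 20 * κ ^ 2).im ^ 2
      = 4 * k ^ 2 + 320 * k ^ 4 := by
    simp only [pow_two κ, Complex.sub_re, Complex.sub_im, Complex.mul_re, Complex.mul_im,
      Complex.re_ofNat, Complex.im_ofNat, hre]
    linear_combination (400 * (κ.im ^ 2 + (k ^ 2 - k ^ 4)) + 800 * k ^ 4 + 4 - 80 * k ^ 2) * him
  rw [e]
  nlinarith [pow_le_one₀ hk0 hk1 (n := 2), pow_le_one₀ hk0 hk1 (n := 4)]

theorem norm_eighteen_mul_sub_sixteen_mul_sq_le {κ : ℂ} {k : ℝ} (hre : κ.re = k ^ 2)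
    (him : κ.im ^ 2 = k ^ 2 - k ^ 4) :
    ‖18 * κ - 16 * κ ^ 2‖ ≤ 10 := by
  apply norm_le_of_sq_add_sq_le (by norm_num)
  have e : (18 * κ - 16 * κ ^ 2).re ^ 2 + (18 * κ - 16 * κ ^ 2).im ^ 2
      = 324 * k ^ 2 - 320 * k ^ 4 := by
    simp only [pow_two κ, Complex.sub_re, Complex.sub_im, Complex.mul_re, Complex.mul_im,
      Complex.re_ofNat, Complex.im_ofNat, hre]
    linear_combination (256 * (κ.im ^ 2 + (k ^ 2 - k ^ 4)) + 512 * k ^ 4 + 324 - 576 * k ^ 2) * him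
  rw [e]
  nlinarith [sq_nonneg (k ^ 2 - 1 / 2)]

theorem norm_nine_mul_sub_sixteen_mul_sq_add_four_mul_cube_le
    {κ : ℂ} {k : ℝ} (hk0 : 0 ≤ k) (hk1 : k ≤ 1)
    (hre : κ.re = k ^ 2) (him : κ.im ^ 2 = k ^ 2 - k ^ 4) :
    ‖9 * κ - 16 * κ ^ 2 + 4 * κ ^ 3‖ ≤ 5 := by
  have e1 : ‖κ‖ ^ 2 = k ^ 2 := by
    rw [Complex.sq_norm, Complex.normSq_apply, hre]; linear_combination him
  have e2 : ‖9 - 16 * κ + 4 * κ ^ 2‖ ^ 2 = 81 - 104 * k ^ 2 + 32 * k ^ 4 := by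
    rw [Complex.sq_norm, Complex.normSq_apply]
    simp only [pow_two κ, Complex.add_re, Complex.add_im, Complex.sub_re, Complex.sub_im,
      Complex.mul_re, Complex.mul_im, Complex.re_ofNat, Complex.im_ofNat, hre]
    linear_combination (16 * (κ.im ^ 2 + (k ^ 2 - k ^ 4)) + 32 * k ^ 4 + 184 - 128 * k ^ 2) * him
  have e3 : 9 * κ - 16 * κ ^ 2 + 4 * κ ^ 3 = κ * (9 - 16 * κ + 4 * κ ^ 2) := by ring
  refine abs_le_of_sq_le_sq' ?_ (by norm_num) |>.2
  rw [e3, norm_mul, mul_pow, e1, e2]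
  have h2 : k ^ 2 ≤ 1 := pow_le_one₀ hk0 hk1
  nlinarith [mul_nonneg (sq_nonneg (k ^ 2 - 1 / 2)) (sub_nonneg.2 h2), sq_nonneg (k ^ 2 - 1 / 2),
    sq_nonneg k]

theorem im_sq_and_norm_le_one_of_re_eq_norm_sq {κ : ℂ} (hre : κ.re = ‖κ‖ ^ 2) :
    κ.im ^ 2 = ‖κ‖ ^ 2 - ‖κ‖ ^ 4 ∧ ‖κ‖ ≤ 1 := by
  have h : ‖κ‖ ^ 2 = κ.re ^ 2 + κ.im ^ 2 := by
    rw [Complex.sq_norm, Complex.normSq_apply]; ring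
  refine ⟨by rw [hre] at h; linear_combination -h, ?_⟩
  have h1 := Complex.re_le_norm κ
  have h2 := norm_nonneg κ
  by_contra! h3
  nlinarith

/-- The expression is 3a₃ - a₂² in Schur coordinates; the value 5 is reached when κ and all of s₀,
r₀ equal 1. -/
theorem norm_quadratic_combination_le {κ s0 s1 r0 r1 : ℂ} {k : ℝ} (hk : ‖κ‖ = k)
    (hre : κ.re = k ^ 2) (hs0 : ‖s0‖ ≤ 1) (hs1 : ‖s1‖ ≤ 1 - ‖s0‖ ^ 2) (hr0 : ‖r0‖ ≤ 1) (hr1 : ‖r1‖ ≤ 1 - ‖r0‖ ^ 2) :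
    ‖2 * s0 ^ 2 + s1 + 2 * s0 * κ * r0 + 2 * κ * r1 + (2 * κ - κ ^ 2) * r0 ^ 2‖ ≤ 5 := by
  have hk0 : 0 ≤ k := hk ▸ norm_nonneg _
  obtain ⟨him, hk1⟩ := im_sq_and_norm_le_one_of_re_eq_norm_sq (hk ▸ hre)
  rw [hk] at him hk1
  have hq := norm_two_mul_sub_sq_le hk0 hk1 hre him
  have n0 := norm_nonneg s0
  have m0 := norm_nonneg r0
  set c := ‖s0‖
  set w := ‖r0‖
  calc _ ≤ 2 * c ^ 2 + ‖s1‖ + 2 * c * k * w + 2 * k * ‖r1‖ + ‖2 * κ - κ ^ 2‖ * w ^ 2 := by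
        refine (norm_add_le _ _).trans (add_le_add ?_ (by simp [w]))
        refine (norm_add_le _ _).trans (add_le_add ?_ (by simp [hk]))
        refine (norm_add_le _ _).trans (add_le_add ?_ (by simp [hk, c, w]))
        refine (norm_add_le _ _).trans (add_le_add ?_ le_rfl)
        simp [c]
    _ ≤ 2 * c ^ 2 + (1 - c ^ 2) + 2 * c * k * w + 2 * k * (1 - w ^ 2) + (3 - 2 * k) * w ^ 2 := by
        gcongr
    _ ≤ 5 := by
        have h1 : c ^ 2 ≤ 1 := pow_le_one₀ n0 hs0
        have h2 : c * (k * w) ≤ 1 * (k * w) := by gcongr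
        -- Once c is replaced by 1 in the mixed term, this is the total coefficient of k; it is
        -- nonnegative, so k = 1 is the worst case and 5 - (1 - w)² remains.
        have h3 : k * (2 * (1 - w) * (1 + 2 * w)) ≤ 1 * (2 * (1 - w) * (1 + 2 * w)) := by
          gcongr
        nlinarith [sq_nonneg (1 - w)]

/-- The expression is 18a₄ - 24a₂a₃ + 4a₂³ in Schur coordinates. The coefficients depending on κ are
bounded separately, which is slightly wasteful: at κ = s₀ = r₀ = 1 the true value is -40. -/
theorem norm_cubic_combination_le {κ s0 s1 s2 r0 r1 r2 : ℂ} {k : ℝ} (hk : ‖κ‖ = k)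
    (hre : κ.re = k ^ 2) (hs0 : ‖s0‖ ≤ 1) (hs1 : ‖s1‖ ≤ 1 - ‖s0‖ ^ 2) (hs2 : ‖s2‖ ≤ 1 - ‖s0‖ ^ 2)
    (hr0 : ‖r0‖ ≤ 1) (hr1 : ‖r1‖ ≤ 1 - ‖r0‖ ^ 2) (hr2 : ‖r2‖ ≤ 1 - ‖r0‖ ^ 2) :
    ‖-2 * s0 ^ 3 + 7 * s0 * s1 + 3 * s2 + κ * r0 * (s1 - 17 * s0 ^ 2)
      + s0 * ((2 * κ - 20 * κ ^ 2) * r0 ^ 2 + 2 * κ * r1)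
      + (9 * κ - 16 * κ ^ 2 + 4 * κ ^ 3) * r0 ^ 3 + (18 * κ - 16 * κ ^ 2) * r0 * r1
      + 9 * κ * r2‖ ≤ 42 := by
  have hk0 : 0 ≤ k := hk ▸ norm_nonneg _
  obtain ⟨him, hk1⟩ := im_sq_and_norm_le_one_of_re_eq_norm_sq (hk ▸ hre)
  rw [hk] at him hk1
  have q1 := norm_two_mul_sub_twenty_mul_sq_le hk0 hk1 hre him
  have q2 := norm_eighteen_mul_sub_sixteen_mul_sq_le hre him
  have q3 := norm_nine_mul_sub_sixteen_mul_sq_add_four_mul_cube_le hk0 hk1 hre him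
  have n0 := norm_nonneg s0
  have m0 := norm_nonneg r0
  set c := ‖s0‖
  set w := ‖r0‖
  have hc : 0 ≤ 1 - c ^ 2 := (norm_nonneg _).trans hs1
  have hw : 0 ≤ 1 - w ^ 2 := (norm_nonneg _).trans hr1
  calc _ ≤ (2 * c ^ 3 + 7 * c * ‖s1‖ + 3 * ‖s2‖ + k * w * (‖s1‖ + 17 * c ^ 2)
        + c * (‖2 * κ - 20 * κ ^ 2‖ * w ^ 2 + 2 * k * ‖r1‖)
        + ‖9 * κ - 16 * κ ^ 2 + 4 * κ ^ 3‖ * w ^ 3 + ‖18 * κ - 16 * κ ^ 2‖ * w * ‖r1‖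
        + 9 * k * ‖r2‖) := by
        refine (norm_add_le _ _).trans (add_le_add ?_ (by simp [hk]))
        refine (norm_add_le _ _).trans (add_le_add ?_ (by simp [w]))
        refine (norm_add_le _ _).trans (add_le_add ?_ (by simp [w]))
        refine (norm_add_le _ _).trans (add_le_add ?_ ?_)
        · refine (norm_add_le _ _).trans (add_le_add ?_ ?_)
          · refine (norm_add_le _ _).trans (add_le_add ?_ (by simp))
            refine (norm_add_le _ _).trans (add_le_add ?_ ?_) <;> simp [c]
          · rw [norm_mul, norm_mul, hk]
            gcongr
            refine (norm_sub_le _ _).trans ?_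
            simp [c]
        · rw [norm_mul]
          gcongr
          refine (norm_add_le _ _).trans ?_
          simp [w, hk]
    _ ≤ 2 * c ^ 3 + 7 * c * (1 - c ^ 2) + 3 * (1 - c ^ 2) + 1 * w * (1 - c ^ 2 + 17 * c ^ 2)
        + c * (18 * w ^ 2 + 2 * 1 * (1 - w ^ 2)) + 5 * w ^ 3 + 10 * w * (1 - w ^ 2)
        + 9 * 1 * (1 - w ^ 2) := by
        gcongr
    _ ≤ 42 := by
        -- This separates c from w. The majorant then splits into 11c³ - 3c² + 9c + 3 ≤ 20 and 11w³
        -- - 9w² + 11w + 9 ≤ 22, with differences factored in `h2` and `h3`.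
        have h1 : c ^ 2 * w + c * w ^ 2 ≤ c ^ 3 + w ^ 3 := by
          nlinarith [mul_nonneg (add_nonneg n0 m0) (sq_nonneg (c - w))]
        have h2 : 0 ≤ (1 - c) * (17 + 8 * c + 11 * c ^ 2) := by
          apply mul_nonneg (by linarith); positivity
        have h3 : 0 ≤ (1 - w) * (13 + 2 * w + 11 * w ^ 2) := by
          apply mul_nonneg (by linarith); positivity
        nlinarith

/-! ### Calculus of Taylor coefficients -/

theorem taylorCoeff_zero (f : ℂ → ℂ) : taylorCoeff f 0 = f 0 := by
  simp [taylorCoeff]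

theorem taylorCoeff_one (f : ℂ → ℂ) : taylorCoeff f 1 = deriv f 0 := by
  simp [taylorCoeff]

theorem taylorCoeff_congr {f g : ℂ → ℂ} (h : f =ᶠ[𝓝 0] g) (n : ℕ) :
    taylorCoeff f n = taylorCoeff g n := by
  rw [taylorCoeff, taylorCoeff, h.iteratedDeriv_eq n]

theorem taylorCoeff_deriv (f : ℂ → ℂ) (n : ℕ) :
    taylorCoeff (deriv f) n = (n + 1) * taylorCoeff f (n + 1) := by
  have h : (n.factorial : ℂ) ≠ 0 := by exact_mod_cast n.factorial_ne_zero
  have h' : (n + 1 : ℂ) ≠ 0 := by exact_mod_cast n.succ_ne_zero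
  simp only [taylorCoeff, iteratedDeriv_succ', Nat.factorial_succ]
  push_cast
  field_simp

theorem taylorCoeff_mul {f g : ℂ → ℂ} (hf : AnalyticAt ℂ f 0) (hg : AnalyticAt ℂ g 0) (n : ℕ) :
    taylorCoeff (fun z => f z * g z) n
      = ∑ i ∈ Finset.range (n + 1), taylorCoeff f i * taylorCoeff g (n - i) := by
  simp only [taylorCoeff]
  rw [iteratedDeriv_fun_mul hf.contDiffAt hg.contDiffAt, Finset.sum_div]
  refine Finset.sum_congr rfl fun i hi => ?_
  have hi' : i ≤ n := Nat.lt_succ_iff.1 (Finset.mem_range.1 hi)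
  have h1 : (n.factorial : ℂ) ≠ 0 := by exact_mod_cast n.factorial_ne_zero
  have h2 : (i.factorial : ℂ) ≠ 0 := by exact_mod_cast i.factorial_ne_zero
  have h3 : ((n - i).factorial : ℂ) ≠ 0 := by exact_mod_cast (n - i).factorial_ne_zero
  have h4 : (n.choose i : ℂ) * i.factorial * (n - i).factorial = n.factorial := by
    exact_mod_cast Nat.choose_mul_factorial_mul_factorial hi'
  rw [← h4]
  have h5 : (n.choose i : ℂ) ≠ 0 := by exact_mod_cast (Nat.choose_pos hi').ne'
  field_simp

theorem taylorCoeff_add {f g : ℂ → ℂ} (hf : AnalyticAt ℂ f 0) (hg : AnalyticAt ℂ g 0) (n : ℕ) :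
    taylorCoeff (fun z => f z + g z) n = taylorCoeff f n + taylorCoeff g n := by
  simp only [taylorCoeff]
  rw [iteratedDeriv_fun_add hf.contDiffAt hg.contDiffAt, add_div]

theorem taylorCoeff_const (c : ℂ) (n : ℕ) :
    taylorCoeff (fun _ => c) n = if n = 0 then c else 0 := by
  cases n <;> simp [taylorCoeff, iteratedDeriv_const]

theorem taylorCoeff_const_mul (c : ℂ) {f : ℂ → ℂ} (n : ℕ) :
    taylorCoeff (fun z => c * f z) n = c * taylorCoeff f n := by
  simp only [taylorCoeff]
  rw [iteratedDeriv_const_mul_field, mul_div_assoc]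

theorem taylorCoeff_id_succ_mul {f : ℂ → ℂ} (hf : AnalyticAt ℂ f 0) (n : ℕ) :
    taylorCoeff (fun z => z * f z) (n + 1) = taylorCoeff f n := by
  rw [taylorCoeff_mul (f := fun z => z) analyticAt_id hf, Finset.sum_eq_single 1]
  · simp [taylorCoeff_one]
  · intro i _ hi
    rcases i with _ | _ | i
    · simp [taylorCoeff_zero]
    · exact absurd rfl hi
    · simp [taylorCoeff, iteratedDeriv_succ', deriv_id'', iteratedDeriv_const]
  · simp

theorem taylorCoeff_id_mul_zero (f : ℂ → ℂ) : taylorCoeff (fun z => z * f z) 0 = 0 := by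
  simp [taylorCoeff_zero]

/-- The Taylor coefficients of `1 + c z s(z)`. -/
theorem taylorCoeff_one_add_mul {s : ℂ → ℂ} (hs : AnalyticAt ℂ s 0) (c : ℂ) (n : ℕ) :
    taylorCoeff (fun z => 1 + c * (z * s z)) n
      = if n = 0 then 1 else c * taylorCoeff s (n - 1) := by
  have h : AnalyticAt ℂ (fun z => z * s z) 0 := analyticAt_id.mul hs
  rw [taylorCoeff_add (f := fun _ => 1) (g := fun z => c * (z * s z)) analyticAt_const
    (analyticAt_const.mul h), taylorCoeff_const,
    taylorCoeff_const_mul]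
  rcases n with _ | n
  · simp [taylorCoeff_zero]
  · simp [taylorCoeff_id_succ_mul hs]

/-! ### Schur functions and their first three coefficients -/

/-- Analytic functions on the unit disk bounded by `1`. -/
structure IsSchur (s : ℂ → ℂ) : Prop where
  analytic : AnalyticOnNhd ℂ s unitDisk
  norm_le_one : ∀ z ∈ unitDisk, ‖s z‖ ≤ 1

theorem isOpen_unitDisk : IsOpen unitDisk := Metric.isOpen_ball

theorem zero_mem_unitDisk : (0 : ℂ) ∈ unitDisk := Metric.mem_ball_self one_pos

theorem IsSchur.analyticAt_zero {s : ℂ → ℂ} (hs : IsSchur s) : AnalyticAt ℂ s 0 :=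
  hs.analytic 0 zero_mem_unitDisk

theorem analyticOnNhd_dslope {f : ℂ → ℂ} (hf : AnalyticOnNhd ℂ f unitDisk) :
    AnalyticOnNhd ℂ (dslope f 0) unitDisk :=
  ((Complex.differentiableOn_dslope (isOpen_unitDisk.mem_nhds zero_mem_unitDisk)).2
    hf.differentiableOn).analyticOnNhd isOpen_unitDisk

theorem mul_dslope_zero {f : ℂ → ℂ} (hf : f 0 = 0) (z : ℂ) : z * dslope f 0 z = f z := by
  simpa [hf] using sub_smul_dslope f 0 z

/-- **Schwarz lemma**: a Schur function vanishing at the origin is `z` times a Schur function. -/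
theorem IsSchur.dslope {f : ℂ → ℂ} (hf : IsSchur f) (h0 : f 0 = 0) : IsSchur (dslope f 0) := by
  refine ⟨analyticOnNhd_dslope hf.analytic, fun z hz => ?_⟩
  have := Complex.norm_dslope_le_div_of_mapsTo_ball (R₂ := 1) hf.analytic.differentiableOn
    (fun w hw => by simpa [h0] using hf.norm_le_one w hw) hz
  simpa using this

/-- One step of the Schur algorithm. -/
theorem IsSchur.exists_schur_step {s : ℂ → ℂ} (hs : IsSchur s) :
    ∃ t, IsSchur t ∧
      ∀ z ∈ unitDisk, s z + -s 0 = z * t z * (1 + -(starRingEnd ℂ) (s 0) * s z) := by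
  rcases (hs.norm_le_one 0 zero_mem_unitDisk).lt_or_eq with hlt | heq
  · have hne : ∀ z ∈ unitDisk, 1 + -(starRingEnd ℂ) (s 0) * s z ≠ 0 := by
      intro z hz h
      have h1 : (starRingEnd ℂ) (s 0) * s z = 1 := by linear_combination -h
      have h2 := congrArg norm h1
      rw [norm_mul, RCLike.norm_conj, norm_one] at h2
      nlinarith [hs.norm_le_one z hz, norm_nonneg (s z), norm_nonneg (s 0)]
    set ω : ℂ → ℂ := fun z => (s z + -s 0) / (1 + -(starRingEnd ℂ) (s 0) * s z)
    have hω : IsSchur ω := by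
      refine ⟨fun z hz => ?_, fun z hz => ?_⟩
      · exact ((hs.analytic z hz).add analyticAt_const).div
          (analyticAt_const.add (analyticAt_const.mul (hs.analytic z hz))) (hne z hz)
      · simp only [ω, norm_div]
        refine div_le_one_of_le₀ (abs_le_of_sq_le_sq' ?_ (norm_nonneg _)).2 (norm_nonneg _)
        have h1 : Complex.normSq (s 0) ≤ 1 := by
          rw [Complex.normSq_eq_norm_sq]; exact pow_le_one₀ (norm_nonneg _) hlt.le
        have h2 : Complex.normSq (s z) ≤ 1 := by
          rw [Complex.normSq_eq_norm_sq]; exact pow_le_one₀ (norm_nonneg _) (hs.norm_le_one z hz)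
        -- |1 - āb|² - |b - a|² = (1 - |a|²)(1 - |b|²) with a = s(0), b = s(z).
        rw [Complex.sq_norm, Complex.sq_norm]
        have h3 := mul_nonneg (sub_nonneg.2 h1) (sub_nonneg.2 h2)
        simp only [Complex.normSq_apply, Complex.add_re, Complex.add_im, Complex.mul_re,
          Complex.mul_im, Complex.neg_re, Complex.neg_im, Complex.one_re, Complex.one_im,
          Complex.conj_re, Complex.conj_im] at h3 ⊢
        linarith
    have hω0 : ω 0 = 0 := by simp [ω]
    refine ⟨_, hω.dslope hω0, fun z hz => ?_⟩
    rw [mul_dslope_zero hω0, div_mul_cancel₀ _ (hne z hz)]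
  -- If |s(0)| = 1, the maximum principle makes s constant, and the relation with denominators
  -- cleared holds with t = 0.
  · refine ⟨fun _ => 0, ⟨fun _ _ => analyticAt_const, by simp⟩, fun z hz => ?_⟩
    have hmax : IsMaxOn (norm ∘ s) unitDisk 0 := by
      intro w hw
      simpa [heq] using hs.norm_le_one w hw
    have := Complex.eqOn_of_isPreconnected_of_isMaxOn_norm
      (convex_ball (0 : ℂ) 1).isPreconnected isOpen_unitDisk hs.analytic.differentiableOn
      zero_mem_unitDisk hmax hz
    simp only [Function.const_apply] at this
    rw [this]; ring

theorem IsSchur.norm_taylorCoeff_zero_le {s : ℂ → ℂ} (hs : IsSchur s) :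
    ‖taylorCoeff s 0‖ ≤ 1 := by
  rw [taylorCoeff_zero]; exact hs.norm_le_one 0 zero_mem_unitDisk

theorem IsSchur.exists_taylorCoeff_eq {s : ℂ → ℂ} (hs : IsSchur s) :
    ∃ t, IsSchur t ∧
      taylorCoeff s 1 = (1 - ‖taylorCoeff s 0‖ ^ 2 : ℝ) * taylorCoeff t 0 ∧
      taylorCoeff s 2 = (1 - ‖taylorCoeff s 0‖ ^ 2 : ℝ) *
        (taylorCoeff t 1 - (starRingEnd ℂ) (taylorCoeff s 0) * taylorCoeff t 0 ^ 2) := by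
  obtain ⟨t, ht, hst⟩ := hs.exists_schur_step
  refine ⟨t, ht, ?_⟩
  have hs0 := hs.analyticAt_zero
  have ht0 := ht.analyticAt_zero
  have hev : (fun z => s z + -s 0) =ᶠ[𝓝 0]
      fun z => (z * t z) * (1 + -(starRingEnd ℂ) (s 0) * s z) := by
    filter_upwards [isOpen_unitDisk.mem_nhds zero_mem_unitDisk] with z hz using hst z hz
  have hzt : AnalyticAt ℂ (fun z => z * t z) 0 := analyticAt_id.mul ht0
  have hcs : AnalyticAt ℂ (fun z => -(starRingEnd ℂ) (s 0) * s z) 0 := analyticAt_const.mul hs0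
  have hr : AnalyticAt ℂ (fun z => 1 + -(starRingEnd ℂ) (s 0) * s z) 0 :=
    analyticAt_const.add hcs
  have key : ∀ n, taylorCoeff (fun z => s z + -s 0) n = _ := fun n =>
    (taylorCoeff_congr hev n).trans (taylorCoeff_mul hzt hr n)
  have e1 := key 1
  have e2 := key 2
  have hadd : ∀ n, taylorCoeff (fun z => 1 + -(starRingEnd ℂ) (s 0) * s z) n
      = (if n = 0 then 1 else 0) + -(starRingEnd ℂ) (s 0) * taylorCoeff s n := fun n => by
    rw [taylorCoeff_add (f := fun _ => 1) (g := fun z => -(starRingEnd ℂ) (s 0) * s z)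
      analyticAt_const hcs, taylorCoeff_const, taylorCoeff_const_mul]
  have hsub : ∀ n, taylorCoeff (fun z => s z + -s 0) n
      = taylorCoeff s n + if n = 0 then -s 0 else 0 := fun n => by
    rw [taylorCoeff_add (g := fun _ => -s 0) hs0 analyticAt_const, taylorCoeff_const]
  have hid0 := taylorCoeff_id_mul_zero t
  have hid1 := taylorCoeff_id_succ_mul ht0 0
  have hid2 := taylorCoeff_id_succ_mul ht0 1
  simp only [Finset.sum_range_succ, Finset.sum_range_zero, hsub, hadd, hid0, hid1, hid2,
    Nat.reduceSub, Nat.reduceAdd, one_ne_zero, if_false, if_true, OfNat.ofNat_ne_zero,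
    zero_add, zero_mul, add_zero] at e1 e2
  rw [← taylorCoeff_zero s] at e1 e2
  have hn : (starRingEnd ℂ) (taylorCoeff s 0) * taylorCoeff s 0
      = ((‖taylorCoeff s 0‖ ^ 2 : ℝ) : ℂ) := by
    rw [mul_comm, Complex.mul_conj, Complex.normSq_eq_norm_sq]
  have f1 : taylorCoeff s 1 = (1 - ‖taylorCoeff s 0‖ ^ 2 : ℝ) * taylorCoeff t 0 := by
    rw [e1, Complex.ofReal_sub, ← hn]; push_cast; ring
  refine ⟨f1, ?_⟩
  rw [e2, f1, Complex.ofReal_sub, ← hn]; push_cast; ring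

/-- The factor 1 - |s₀|² comes out of one Schur step. A second step gives |t₁| ≤ 1 - |t₀|², which
absorbs the term s̄₀t₀². -/
theorem IsSchur.norm_taylorCoeff_le {s : ℂ → ℂ} (hs : IsSchur s) :
    ‖taylorCoeff s 1‖ ≤ 1 - ‖taylorCoeff s 0‖ ^ 2 ∧
      ‖taylorCoeff s 2‖ ≤ 1 - ‖taylorCoeff s 0‖ ^ 2 := by
  obtain ⟨t, ht, h1, h2⟩ := hs.exists_taylorCoeff_eq
  obtain ⟨u, hu, h3, -⟩ := ht.exists_taylorCoeff_eq
  have hs0 := hs.norm_taylorCoeff_zero_le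
  have ht0 := ht.norm_taylorCoeff_zero_le
  have hu0 := hu.norm_taylorCoeff_zero_le
  have hs' : 0 ≤ 1 - ‖taylorCoeff s 0‖ ^ 2 := sub_nonneg.2 (pow_le_one₀ (norm_nonneg _) hs0)
  have ht' : 0 ≤ 1 - ‖taylorCoeff t 0‖ ^ 2 := sub_nonneg.2 (pow_le_one₀ (norm_nonneg _) ht0)
  constructor
  · rw [h1, norm_mul, Complex.norm_of_nonneg hs']
    exact mul_le_of_le_one_right hs' ht0
  · rw [h2, norm_mul, Complex.norm_of_nonneg hs']
    refine mul_le_of_le_one_right hs' ((norm_sub_le _ _).trans ?_)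
    rw [h3, norm_mul, Complex.norm_of_nonneg ht', norm_mul, RCLike.norm_conj, norm_pow]
    have a1 : (1 - ‖taylorCoeff t 0‖ ^ 2) * ‖taylorCoeff u 0‖ ≤ 1 - ‖taylorCoeff t 0‖ ^ 2 :=
      mul_le_of_le_one_right ht' hu0
    have a2 : ‖taylorCoeff s 0‖ * ‖taylorCoeff t 0‖ ^ 2 ≤ ‖taylorCoeff t 0‖ ^ 2 :=
      mul_le_of_le_one_left (by positivity) hs0
    linarith

/-- A function with values in the half-plane `0 ≤ Re (e^{iα} h)` and `h 0 = 1` is subordinate to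
the Möbius map `(1 + e^{-2iα} z) / (1 - z)`. -/
theorem exists_schur_of_re_nonneg {h : ℂ → ℂ} (hh : AnalyticOnNhd ℂ h unitDisk) (h0 : h 0 = 1)
    {α : ℝ} (hα : 0 < Real.cos α)
    (hre : ∀ z ∈ unitDisk, 0 ≤ (Complex.exp (α * Complex.I) * h z).re) :
    ∃ s, IsSchur s ∧ ∀ z ∈ unitDisk,
      h z * (1 + -1 * (z * s z)) = 1 + Complex.exp (-(2 * α) * Complex.I) * (z * s z) := by
  set e := Complex.exp (α * Complex.I)
  have he : e ≠ 0 := Complex.exp_ne_zero _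
  have her : e.re = Real.cos α := Complex.exp_ofReal_mul_I_re α
  have hx : e * Complex.exp (-(2 * α) * Complex.I) = (starRingEnd ℂ) e := by
    rw [← Complex.exp_conj, ← Complex.exp_add]
    congr 1
    simp only [map_mul, Complex.conj_ofReal, Complex.conj_I]
    ring
  set x := Complex.exp (-(2 * α) * Complex.I)
  have hne : ∀ z ∈ unitDisk, h z + x ≠ 0 := by
    intro z hz h'
    have h1 : e * h z + (starRingEnd ℂ) e = 0 := by
      rw [← hx, ← mul_add, h', mul_zero]
    have h2 := congrArg Complex.re h1
    rw [Complex.add_re, Complex.conj_re, Complex.zero_re, her] at h2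
    linarith [hre z hz]
  set ω : ℂ → ℂ := fun z => (h z - 1) / (h z + x)
  have hω : IsSchur ω := by
    refine ⟨fun z hz => ((hh z hz).sub analyticAt_const).div ((hh z hz).add analyticAt_const)
      (hne z hz), fun z hz => ?_⟩
    have h1 : ω z = (e * h z - e) / (e * h z + (starRingEnd ℂ) e) := by
      rw [← hx, ← mul_add, ← mul_sub_one, mul_div_mul_left _ _ he]
    rw [h1, norm_div]
    refine div_le_one_of_le₀ (abs_le_of_sq_le_sq' ?_ (norm_nonneg _)).2 (norm_nonneg _)
    -- With w = e^{iα}h(z), |w + e^{-iα}|² - |w - e^{iα}|² = 4 cos α · Re w.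
    have h3 := mul_nonneg (hre z hz) (her ▸ hα.le)
    rw [Complex.sq_norm, Complex.sq_norm]
    simp only [Complex.normSq_apply, Complex.add_re, Complex.add_im, Complex.sub_re,
      Complex.sub_im, Complex.conj_re, Complex.conj_im]
    nlinarith
  have hω0 : ω 0 = 0 := by simp [ω, h0]
  refine ⟨_, hω.dslope hω0, fun z hz => ?_⟩
  rw [mul_dslope_zero hω0]
  simp only [ω]
  have := hne z hz
  field_simp
  ring

/-! ### Univalence and starlikeness -/

/-- At a critical point g - g(z₀) = ψⁿ with n ≥ 2 and ψ a local coordinate. Points where ψ equals y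
and ζy, with ζ a primitive n-th root of unity, then have the same image. -/
theorem deriv_ne_zero_of_injOn {g : ℂ → ℂ} {U : Set ℂ} (hU : IsOpen U)
    (hg : AnalyticOnNhd ℂ g U) (hinj : InjOn g U) {z₀ : ℂ} (hz₀ : z₀ ∈ U) : deriv g z₀ ≠ 0 := by
  intro hd
  have hF : AnalyticAt ℂ (fun z => g z - g z₀) z₀ := (hg z₀ hz₀).sub analyticAt_const
  have hne : ¬ ∀ᶠ z in 𝓝 z₀, g z - g z₀ = 0 := by
    intro h
    have h1 : ∀ᶠ z in 𝓝 z₀, z = z₀ := by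
      filter_upwards [h, hU.mem_nhds hz₀] with z hz hzU
      exact hinj hzU hz₀ (sub_eq_zero.1 hz)
    obtain ⟨z, hz, hz'⟩ := ((h1.filter_mono nhdsWithin_le_nhds).and
      (self_mem_nhdsWithin : {z₀}ᶜ ∈ 𝓝[≠] z₀)).exists
    exact hz' hz
  obtain ⟨n, h, hh, hh0, hFe⟩ := hF.exists_eventuallyEq_pow_smul_nonzero_iff.2 hne
  simp only [smul_eq_mul] at hFe
  have hn0 : n ≠ 0 := by
    rintro rfl
    have := hFe.self_of_nhds
    simp only [sub_self, pow_zero, one_mul] at this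
    exact hh0 this.symm
  have hn1 : n ≠ 1 := by
    rintro rfl
    have h1 : HasDerivAt (fun z => (z - z₀) ^ 1 * h z) (h z₀) z₀ := by
      have := ((hasDerivAt_id z₀).sub_const z₀).mul hh.differentiableAt.hasDerivAt
      simpa using! this
    have h2 : HasDerivAt (fun z => g z - g z₀) (h z₀) z₀ := h1.congr_of_eventuallyEq hFe
    have h3 := ((hg z₀ hz₀).differentiableAt.hasDerivAt.sub_const (g z₀)).unique h2
    exact hh0 (h3 ▸ hd)
  obtain ⟨c, hc⟩ := IsAlgClosed.exists_pow_nat_eq (h z₀) (Nat.pos_of_ne_zero hn0)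
  have hc0 : c ≠ 0 := by
    rintro rfl
    rw [zero_pow hn0] at hc
    exact hh0 hc.symm
  -- An analytic n-th root of h near z₀: the quotient h(z)/h(z₀) is 1 at z₀, so the principal
  -- logarithm is analytic there.
  let r : ℂ → ℂ := fun z => c * Complex.exp (Complex.log (h z / h z₀) / n)
  have hq : AnalyticAt ℂ (fun z => h z / h z₀) z₀ := hh.div_const
  have hr : AnalyticAt ℂ r z₀ := by
    refine analyticAt_const.mul (AnalyticAt.cexp (AnalyticAt.div_const (hq.clog ?_)))
    rw [div_self hh0]
    exact Complex.one_mem_slitPlane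
  have hnC : (n : ℂ) ≠ 0 := by exact_mod_cast hn0
  have hrn : ∀ᶠ z in 𝓝 z₀, r z ^ n = h z := by
    filter_upwards [hh.continuousAt.eventually_ne hh0] with z hz
    simp only [r, mul_pow, hc]
    rw [← Complex.exp_nat_mul, mul_div_cancel₀ _ hnC, Complex.exp_log (div_ne_zero hz hh0)]
    field_simp
  let ψ : ℂ → ℂ := fun z => (z - z₀) * r z
  have hψ : AnalyticAt ℂ ψ z₀ := (analyticAt_id.sub analyticAt_const).mul hr
  have hψ0 : ψ z₀ = 0 := by simp [ψ]
  have hψd : HasDerivAt ψ (r z₀) z₀ := by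
    have := ((hasDerivAt_id z₀).sub_const z₀).mul hr.differentiableAt.hasDerivAt
    simpa using! this
  have hrz : r z₀ ≠ 0 := mul_ne_zero hc0 (Complex.exp_ne_zero _)
  have hψs : HasStrictDerivAt ψ (r z₀) z₀ := by
    have := hψ.hasStrictDerivAt
    rwa [hψd.deriv] at this
  have hmap := hψs.map_nhds_eq hrz
  rw [hψ0] at hmap
  have hV : {z | z ∈ U ∧ g z - g z₀ = ψ z ^ n} ∈ 𝓝 z₀ := by
    filter_upwards [hFe, hrn, hU.mem_nhds hz₀] with z h1 h2 h3
    exact ⟨h3, by rw [h1]; simp only [ψ, mul_pow, h2]⟩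
  have hW : ψ '' {z | z ∈ U ∧ g z - g z₀ = ψ z ^ n} ∈ 𝓝 (0 : ℂ) := by
    rw [← hmap]
    exact image_mem_map hV
  have hζ := Complex.isPrimitiveRoot_exp n hn0
  set ζ := Complex.exp (2 * Real.pi * Complex.I / n)
  have hW' : ∀ᶠ y in 𝓝 (0 : ℂ), ζ * y ∈ ψ '' {z | z ∈ U ∧ g z - g z₀ = ψ z ^ n} := by
    have ht : Tendsto (fun y : ℂ => ζ * y) (𝓝 0) (𝓝 0) := by
      have : ContinuousAt (fun y : ℂ => ζ * y) 0 := by fun_prop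
      simpa [ContinuousAt] using this
    exact ht hW
  have hex : ∀ᶠ y in 𝓝[≠] (0 : ℂ), y ∈ ψ '' {z | z ∈ U ∧ g z - g z₀ = ψ z ^ n} ∧
      ζ * y ∈ ψ '' {z | z ∈ U ∧ g z - g z₀ = ψ z ^ n} :=
    (Filter.Eventually.and hW hW').filter_mono nhdsWithin_le_nhds
  obtain ⟨y, ⟨⟨a, ⟨haU, ha⟩, hay⟩, ⟨b, ⟨hbU, hb⟩, hby⟩⟩, hy⟩ :=
    (hex.and (self_mem_nhdsWithin : {(0 : ℂ)}ᶜ ∈ 𝓝[≠] 0)).exists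
  have hab : g a = g b := by
    rw [hay] at ha
    rw [hby, mul_pow, hζ.pow_eq_one, one_mul] at hb
    exact sub_left_injective (ha.trans hb.symm)
  obtain rfl := hinj haU hbU hab
  have : ζ = 1 := by
    have h1 : ζ * y = 1 * y := by rw [← hby, hay, one_mul]
    exact mul_right_cancel₀ hy h1
  exact hn1 (Nat.dvd_one.1 ((hζ.pow_eq_one_iff_dvd 1).1 (by rw [pow_one, this])))

/-- The analytic characterization of starlikeness, `0 ≤ Re (z g'(z) / g(z))`. -/
theorem IsStarlike.re_nonneg {g : ℂ → ℂ} (hg : IsStarlike g) {z : ℂ} (hz : z ∈ unitDisk) :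
    0 ≤ (z * deriv g z / g z).re := by
  have hU : IsOpen unitDisk := Metric.isOpen_ball
  have h0 : (0 : ℂ) ∈ unitDisk := Metric.mem_ball_self one_pos
  have hd : ∀ w ∈ unitDisk, deriv g w ≠ 0 := fun w hw =>
    deriv_ne_zero_of_injOn hU hg.normalized.analytic hg.univalent hw
  set G := Function.invFunOn g unitDisk
  have hGl : ∀ w ∈ unitDisk, G (g w) = w := fun w hw => hg.univalent.leftInvOn_invFunOn hw
  have hGd : ∀ w ∈ unitDisk, HasStrictDerivAt G (deriv g w)⁻¹ (g w) := by
    intro w hw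
    refine (hg.normalized.analytic w hw).hasStrictDerivAt.to_local_left_inverse (hd w hw) ?_
    filter_upwards [hU.mem_nhds hw] with x hx using hGl x hx
  have hmem : ∀ t ∈ Icc (0 : ℝ) 1, ∀ w ∈ unitDisk, ∃ v ∈ unitDisk, g v = t * g w := by
    intro t ht w hw
    have := hg.starConvex_image (mem_image_of_mem g hw) (sub_nonneg.2 ht.2) ht.1 (by ring)
    simpa using this
  -- Schwarz lemma for w ↦ g⁻¹(t g(w)), a self-map of the disk fixing 0 because the image of g is
  -- starlike.
  have hle : ∀ t ∈ Icc (0 : ℝ) 1, ‖G (t * g z)‖ ≤ ‖z‖ := by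
    intro t ht
    refine Complex.norm_le_norm_of_mapsTo_ball (f := fun w => G (t * g w)) (R := 1) ?_ ?_ ?_
      (mem_ball_zero_iff.1 hz)
    · intro w hw
      obtain ⟨v, hv, hvw⟩ := hmem t ht w hw
      have h1 := hGd v hv
      rw [hvw] at h1
      have h2 : DifferentiableAt ℂ (fun w => (t : ℂ) * g w) w :=
        ((hg.normalized.analytic w hw).differentiableAt).const_mul _
      exact (h1.hasDerivAt.differentiableAt.comp w h2).differentiableWithinAt
    · intro w hw
      obtain ⟨v, hv, hvw⟩ := hmem t ht w hw
      simp only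
      rw [← hvw, hGl v hv]
      exact Metric.ball_subset_closedBall hv
    · simp only [hg.normalized.map_zero, mul_zero]
      have := hGl 0 h0
      rwa [hg.normalized.map_zero] at this
  have hpath : HasDerivAt (fun t : ℝ => G (t * g z)) ((deriv g z)⁻¹ * g z) 1 := by
    have h1 : HasDerivAt (fun t : ℝ => (t : ℂ) * g z) (g z) 1 := by
      simpa using! (Complex.ofRealCLM.hasDerivAt (x := (1 : ℝ))).mul_const (g z)
    have h2 := (hGd z hz).hasDerivAt
    rw [show g z = ((1 : ℝ) : ℂ) * g z by simp] at h2
    exact h2.comp (1 : ℝ) h1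
  have hsq := hpath.norm_sq
  -- On [0, 1] the function |g⁻¹(t g(z))|² is at most |z|², its value at t = 1, so its derivative
  -- there is nonnegative.
  have hlim : 0 ≤ 2 * inner ℝ (G (((1 : ℝ) : ℂ) * g z)) ((deriv g z)⁻¹ * g z) := by
    by_contra! hneg
    have h1 : ∀ᶠ t in 𝓝[<] (1 : ℝ), slope (fun t : ℝ => ‖G (t * g z)‖ ^ 2) 1 t < 0 :=
      ((hasDerivAt_iff_tendsto_slope.1 hsq).mono_left
        (nhdsWithin_mono _ fun _ h => ne_of_lt h)).eventually_lt_const hneg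
    have h2 : ∀ᶠ t in 𝓝[<] (1 : ℝ), 0 < t :=
      ((lt_mem_nhds one_pos).filter_mono nhdsWithin_le_nhds)
    obtain ⟨t, ⟨ht1, ht0⟩, htlt⟩ := ((h1.and h2).and self_mem_nhdsWithin).exists
    have htlt : t < 1 := htlt
    have h3 := hle t ⟨ht0.le, htlt.le⟩
    rw [slope_def_field, div_lt_iff_of_neg (by linarith)] at ht1
    simp only [Complex.ofReal_one, one_mul, zero_mul, hGl z hz] at ht1
    have h4 : ‖G (t * g z)‖ ^ 2 ≤ ‖z‖ ^ 2 := by gcongr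
    linarith
  rw [Complex.ofReal_one, one_mul, hGl z hz] at hlim
  have hin : 0 ≤ (z * (starRingEnd ℂ) ((deriv g z)⁻¹ * g z)).re := by
    rw [Complex.inner] at hlim
    simp only [Complex.mul_re, Complex.conj_re, Complex.conj_im] at hlim ⊢
    linarith
  -- With q = g/g', 1/q is a nonnegative multiple of q̄, so the sign of Re(z q̄) passes to Re(z/q).
  -- Division by zero at z = 0 is harmless.
  have he : z * deriv g z / g z = z * (starRingEnd ℂ) ((deriv g z)⁻¹ * g z)
      * (((Complex.normSq ((deriv g z)⁻¹ * g z))⁻¹ : ℝ) : ℂ) := by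
    rw [mul_assoc, ← Complex.inv_def, mul_inv, inv_inv, div_eq_mul_inv, mul_assoc]
  rw [he, Complex.re_mul_ofReal]
  exact mul_nonneg hin (inv_nonneg.2 (Complex.normSq_nonneg _))

/-! ### From the geometric conditions to coefficient formulas -/

theorem IsStarlike.dslope_ne_zero {g : ℂ → ℂ} (hg : IsStarlike g) {z : ℂ} (hz : z ∈ unitDisk) :
    dslope g 0 z ≠ 0 := by
  rcases eq_or_ne z 0 with rfl | hz0
  · simp [hg.normalized.deriv_zero]
  · intro h
    have h1 := mul_dslope_zero hg.normalized.map_zero z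
    rw [h, mul_zero, ← hg.normalized.map_zero] at h1
    exact hz0 (hg.univalent zero_mem_unitDisk hz h1).symm

theorem mul_div_eq_div_dslope {f g : ℂ → ℂ} (hg : g 0 = 0) {z : ℂ} (hz : z ≠ 0) :
    z * f z / g z = f z / dslope g 0 z := by
  rw [← mul_dslope_zero hg z, mul_div_mul_left _ _ hz]

/-- If `g` is starlike, `u 0 = 1` and `0 ≤ Re (e^{iα} z u(z) / g(z))`, then
`u(z) (1 - z s(z)) = (g(z) / z) (1 + e^{-2iα} z s(z))` for some Schur function `s`; this is the
resulting relation between Taylor coefficients. -/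
theorem IsStarlike.exists_schur {g u : ℂ → ℂ} (hg : IsStarlike g)
    (hu : AnalyticOnNhd ℂ u unitDisk) (hu0 : u 0 = 1) {α : ℝ} (hα : 0 < Real.cos α)
    (hre : ∀ z ∈ unitDisk, z ≠ 0 → 0 ≤ (Complex.exp (α * Complex.I) * (z * u z / g z)).re) :
    ∃ s, IsSchur s ∧ ∀ n,
      ∑ i ∈ Finset.range (n + 1), taylorCoeff u i *
          (if n - i = 0 then 1 else -1 * taylorCoeff s (n - i - 1))
        = ∑ i ∈ Finset.range (n + 1), taylorCoeff (dslope g 0) i *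
          (if n - i = 0 then 1 else
            Complex.exp (-(2 * α) * Complex.I) * taylorCoeff s (n - i - 1)) := by
  have hG := analyticOnNhd_dslope hg.normalized.analytic
  have hG0 : dslope g 0 0 = 1 := by simp [hg.normalized.deriv_zero]
  obtain ⟨s, hs, hsz⟩ := exists_schur_of_re_nonneg (h := fun z => u z / dslope g 0 z)
    (fun z hz => (hu z hz).div (hG z hz) (hg.dslope_ne_zero hz))
    (by rw [hu0, hG0, div_one]) hα
    (fun z hz => by
      rcases eq_or_ne z 0 with rfl | hz0
      · simp only [hu0, hG0, div_one, mul_one, Complex.exp_ofReal_mul_I_re, hα.le]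
      · rw [← mul_div_eq_div_dslope hg.normalized.map_zero hz0]
        exact hre z hz hz0)
  refine ⟨s, hs, fun n => ?_⟩
  have hzs : AnalyticAt ℂ (fun z => z * s z) 0 := analyticAt_id.mul hs.analyticAt_zero
  have hc : ∀ c : ℂ, AnalyticAt ℂ (fun z => 1 + c * (z * s z)) 0 := fun c =>
    analyticAt_const.add (analyticAt_const.mul hzs)
  have hev : (fun z => u z * (1 + -1 * (z * s z))) =ᶠ[𝓝 0] fun z => dslope g 0 z *
      (1 + Complex.exp (-(2 * α) * Complex.I) * (z * s z)) := by
    filter_upwards [isOpen_unitDisk.mem_nhds zero_mem_unitDisk] with z hz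
    rw [← hsz z hz, ← mul_assoc (dslope g 0 z), mul_div_cancel₀ _ (hg.dslope_ne_zero hz)]
  have h := taylorCoeff_congr hev n
  rw [taylorCoeff_mul (hu 0 zero_mem_unitDisk) (hc _),
    taylorCoeff_mul (hG 0 zero_mem_unitDisk) (hc _)] at h
  simpa only [taylorCoeff_one_add_mul hs.analyticAt_zero] using h

theorem IsNormalizedAnalytic.taylorCoeff_dslope {g : ℂ → ℂ} (hg : IsNormalizedAnalytic g) (n : ℕ) :
    taylorCoeff (dslope g 0) n = taylorCoeff g (n + 1) := by
  rw [← taylorCoeff_id_succ_mul (analyticOnNhd_dslope hg.analytic 0 zero_mem_unitDisk)]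
  congr 1
  exact funext (mul_dslope_zero hg.map_zero)

theorem IsNormalizedAnalytic.taylorCoeff_one {g : ℂ → ℂ} (hg : IsNormalizedAnalytic g) :
    taylorCoeff g 1 = 1 := by
  rw [_root_.taylorCoeff_one, hg.deriv_zero]

/-- The coefficients of a starlike function in terms of a Schur function. -/
theorem IsStarlike.exists_schur_taylorCoeff {g : ℂ → ℂ} (hg : IsStarlike g) :
    ∃ s, IsSchur s ∧
      taylorCoeff g 2 = 2 * taylorCoeff s 0 ∧
      taylorCoeff g 3 = 3 * taylorCoeff s 0 ^ 2 + taylorCoeff s 1 ∧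
      3 * taylorCoeff g 4 = 12 * taylorCoeff s 0 ^ 3 + 10 * taylorCoeff s 0 * taylorCoeff s 1
        + 2 * taylorCoeff s 2 := by
  obtain ⟨s, hs, h⟩ := hg.exists_schur (u := deriv g) (α := 0) hg.normalized.analytic.deriv
    hg.normalized.deriv_zero (by simp) (fun z hz _ => by simpa using hg.re_nonneg hz)
  have e1 := h 1
  have e2 := h 2
  have e3 := h 3
  simp only [Finset.sum_range_succ, Finset.sum_range_zero, taylorCoeff_deriv,
    hg.normalized.taylorCoeff_dslope, hg.normalized.taylorCoeff_one, Nat.reduceAdd,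
    Nat.reduceSub, zero_add, if_true, one_ne_zero, if_false, OfNat.ofNat_ne_zero,
    Complex.ofReal_zero, mul_zero, neg_zero, zero_mul, Complex.exp_zero] at e1 e2 e3
  push_cast at e1 e2 e3
  have f1 : taylorCoeff g 2 = 2 * taylorCoeff s 0 := by linear_combination e1
  rw [f1] at e2 e3
  have f2 : taylorCoeff g 3 = 3 * taylorCoeff s 0 ^ 2 + taylorCoeff s 1 := by
    linear_combination e2 / 2
  rw [f2] at e3
  exact ⟨s, hs, f1, f2, by linear_combination e3⟩

/-- The coefficients of a close-to-convex function in terms of two Schur functions. -/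
theorem IsCloseToConvex.exists_schur_taylorCoeff {f : ℂ → ℂ} (hf : IsCloseToConvex f) :
    ∃ s r κ, IsSchur s ∧ IsSchur r ∧ κ.re = ‖κ‖ ^ 2 ∧
      taylorCoeff f 2 = taylorCoeff s 0 + κ * taylorCoeff r 0 ∧
      3 * taylorCoeff f 3 = 3 * taylorCoeff s 0 ^ 2 + taylorCoeff s 1
        + 4 * taylorCoeff s 0 * κ * taylorCoeff r 0
        + 2 * κ * (taylorCoeff r 0 ^ 2 + taylorCoeff r 1) ∧
      6 * taylorCoeff f 4 = 6 * taylorCoeff s 0 ^ 3 + 5 * taylorCoeff s 0 * taylorCoeff s 1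
        + taylorCoeff s 2 + 3 * κ * taylorCoeff r 0 * (3 * taylorCoeff s 0 ^ 2 + taylorCoeff s 1)
        + 6 * taylorCoeff s 0 * κ * (taylorCoeff r 0 ^ 2 + taylorCoeff r 1)
        + 3 * κ * (taylorCoeff r 0 ^ 3 + 2 * taylorCoeff r 0 * taylorCoeff r 1
          + taylorCoeff r 2) := by
  obtain ⟨hf, g, hg, α, hα, hre⟩ := hf
  obtain ⟨s, hs, b2, b3, b4⟩ := hg.exists_schur_taylorCoeff
  obtain ⟨r, hr, h⟩ := hg.exists_schur (u := deriv f) (α := α) hf.analytic.deriv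
    hf.deriv_zero (Real.cos_pos_of_mem_Ioo hα) (fun z hz hz0 => (hre z hz hz0).le)
  have hx : Complex.exp (-(2 * α) * Complex.I)
      = (Real.cos (2 * α) : ℂ) - Real.sin (2 * α) * Complex.I := by
    rw [Complex.exp_mul_I, Complex.cos_neg, Complex.sin_neg]
    push_cast
    ring
  set x := Complex.exp (-(2 * α) * Complex.I)
  -- Since |x| = 1, κ = (1 + x)/2 satisfies Re κ = |κ|². Only this property of α is kept from here
  -- on.
  have hxκ : x = 2 * ((1 + x) / 2) - 1 := by ring
  have hκ : ((1 + x) / 2).re = ‖(1 + x) / 2‖ ^ 2 := by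
    have h1 : x.re = Real.cos (2 * α) := by
      rw [hx, Complex.sub_re, Complex.re_ofReal_mul, Complex.ofReal_re, Complex.I_re]; ring
    have h2 : x.im = -Real.sin (2 * α) := by
      rw [hx, Complex.sub_im, Complex.im_ofReal_mul, Complex.ofReal_im, Complex.I_im]; ring
    rw [Complex.sq_norm, Complex.normSq_apply, Complex.div_ofNat_re, Complex.div_ofNat_im,
      Complex.add_re, Complex.add_im, Complex.one_re, Complex.one_im, h1, h2]
    linear_combination -(1 / 4 : ℝ) * Real.sin_sq_add_cos_sq (2 * α)
  generalize (1 + x) / 2 = κ at hκ hxκ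
  have e1 := h 1
  have e2 := h 2
  have e3 := h 3
  simp only [Finset.sum_range_succ, Finset.sum_range_zero, taylorCoeff_deriv,
    hg.normalized.taylorCoeff_dslope, hg.normalized.taylorCoeff_one, hf.taylorCoeff_one,
    Nat.reduceAdd, Nat.reduceSub, zero_add, if_true, one_ne_zero, if_false,
    OfNat.ofNat_ne_zero, hxκ, b2, b3] at e1 e2 e3
  push_cast at e1 e2 e3
  have f1 : taylorCoeff f 2 = taylorCoeff s 0 + κ * taylorCoeff r 0 := by
    linear_combination e1 / 2
  rw [f1] at e2 e3
  have f2 : 3 * taylorCoeff f 3 = 3 * taylorCoeff s 0 ^ 2 + taylorCoeff s 1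
        + 4 * taylorCoeff s 0 * κ * taylorCoeff r 0
        + 2 * κ * (taylorCoeff r 0 ^ 2 + taylorCoeff r 1) := by
    linear_combination e2
  refine ⟨s, r, κ, hs, hr, hκ, f1, f2, ?_⟩
  linear_combination e3 * 3 / 2 + b4 / 2 + f2 * taylorCoeff r 0 * 3 / 2

/-! ### The Hankel-type bound -/

theorem lemma2p5 (f : ℂ → ℂ) (hf : IsCloseToConvex f) :
    ‖taylorCoeff f 2 * taylorCoeff f 4 - 2 * taylorCoeff f 3 ^ 2‖ ≤ 21 / 2 := by
  obtain ⟨s, r, κ, hs, hr, hκ, f2, f3, f4⟩ := hf.exists_schur_taylorCoeff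
  have hs0 := hs.norm_taylorCoeff_zero_le
  have hr0 := hr.norm_taylorCoeff_zero_le
  obtain ⟨hs1, hs2⟩ := hs.norm_taylorCoeff_le
  obtain ⟨hr1, hr2⟩ := hr.norm_taylorCoeff_le
  have h2 : ‖taylorCoeff f 2‖ ≤ 2 := by
    rw [f2]
    refine (norm_add_le _ _).trans ?_
    rw [norm_mul]
    have := mul_le_one₀ (im_sq_and_norm_le_one_of_re_eq_norm_sq hκ).2 (norm_nonneg _) hr0
    linarith
  have hq := norm_quadratic_combination_le rfl hκ hs0 hs1 hr0 hr1
  have hc := norm_cubic_combination_le rfl hκ hs0 hs1 hs2 hr0 hr1 hr2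
  set a2 := taylorCoeff f 2
  set a3 := taylorCoeff f 3
  set a4 := taylorCoeff f 4
  have hq' : ‖3 * a3 - a2 ^ 2‖ ≤ 5 := by
    convert hq using 2
    rw [f3, f2]; ring
  have hc' : ‖18 * a4 - 24 * a2 * a3 + 4 * a2 ^ 3‖ ≤ 42 := by
    convert hc using 2
    rw [show 18 * a4 - 24 * a2 * a3 + 4 * a2 ^ 3
      = 3 * (6 * a4) - 8 * a2 * (3 * a3) + 4 * a2 ^ 3 by ring, f4, f3, f2]
    ring
  -- The square cancels -2a₃² and leaves a remainder divisible by a₂.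
  have key : a2 * a4 - 2 * a3 ^ 2 = a2 * (18 * a4 - 24 * a2 * a3 + 4 * a2 ^ 3) / 18
      - 2 * (3 * a3 - a2 ^ 2) ^ 2 / 9 := by ring
  rw [key]
  calc _ ≤ ‖a2‖ * ‖18 * a4 - 24 * a2 * a3 + 4 * a2 ^ 3‖ / 18
        + 2 * ‖3 * a3 - a2 ^ 2‖ ^ 2 / 9 := by
        refine (norm_sub_le _ _).trans (le_of_eq ?_)
        simp only [norm_div, norm_mul, norm_pow, Complex.norm_ofNat]
    _ ≤ 2 * 42 / 18 + 2 * 5 ^ 2 / 9 := by gcongr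
    _ ≤ 21 / 2 := by norm_num
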